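/- Let $\mathbb{F}_q$ be a finite field with $q \equiv 1 \pmod 4$ elements, written $q = 2^A m + 1$ with $A \ge 2$ and $m$ odd. Let $r \ge 3$ be odd with $\gcd(q,r)=1$, let $d_r = \operatorname{ord}_r(q)$ be the multiplicative order of $q$ modulo $r$, and let $K = v_2(q^{d_r}-1)$ be the exponent of $2$ in $q^{d_r}-1$. In an algebraic closure of $\mathbb{F}_q$ let $U_n$ be the set of primitive $2^n$-th roots of unity and $\Omega(r)$ the set of primitive $r$-th roots of unity. For $w \in \Omega(r)$ let $S_{i,w} = S_i(w, w^q, \dots, w^{q^{d_r-1}})$, where $S_i$ is the $i$-th elementary symmetric polynomial and $S_0=1$. Every product below is taken over the \emph{distinct} polynomials of the indicated form, and ``complete factorization over $\mathbb{F}_q$'' means that these polynomials have coefficients in $\mathbb{F}_q$ and are monic and irreducible over $\mathbb{F}_q$. Write $\Phi_N$ for the $N$-th cyclotomic polynomial over $\mathbb{F}_q$. 1. If $2 \le n \le A$, then $$\Phi_{2^n r}(x) = \prod_{u\in U_n}\prod_{w\in\Omega(r)}\left(\sum_{i=0}^{d_r} u^i S_{i,w}\, x^{d_r-i}\right)$$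 is the complete factorization of $\Phi_{2^n r}$ over $\mathbb{F}_q$. For $n=1$ the complete factorization is the same expression with $u=1$: $$\Phi_{2r}(x) = \prod_{w\in\Omega(r)}\left(\sum_{i=0}^{d_r} S_{i,w}\, x^{d_r-i}\right).$$ 2. Let $n > A$. (a) If $d_r$ is odd, then $$\Phi_{2^n r}(x) = \prod_{u\in U_A}\prod_{w\in\Omega(r)}\left(\sum_{i=0}^{d_r} u^i S_{i,w}\, x^{2^{n-A}(d_r-i)}\right)$$ is the complete factorization of $\Phi_{2^n r}$ over $\mathbb{F}_q$. (b) Let $d_r$ be even. (i) If $A < n \le K$, the complete factorization of $\Phi_{2^n r}$ over $\mathbb{F}_q$ is $$\Phi_{2^n r}(x) = \prod_{u\in U_A}\prod_{w\in\Omega(r)}\left(x^{d_r} + \sum_{i=1}^{d_r} a_{n,i}\, x^{d_r-i}\right),$$ where, for each $u \in U_A$ and $w \in \Omega(r)$, $(a_{n,1},\dots,a_{n,d_r})$ runs over all vectors in $\mathbb{F}_q^{d_r}$ obtained from the initial values $a_{A,k} = u^k S_{k,w} \in \mathbb{F}_q$, $1\le k\le d_r$, by solving successively for $\nu = A+1,\dots,n$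 the system of non-linear recurrence relations $$\sum_{\substack{i+j=2k\\ 0\le i,j\le d_r}} (-1)^j a_{\nu,i}\, a_{\nu,j} = a_{\nu-1,k}, \qquad 1\le k\le d_r,\qquad a_{\nu,0}=1,$$ in $\mathbb{F}_q$; at each of these steps the system has a solution in $\mathbb{F}_q$. (ii) If $n > K$, the complete factorization of $\Phi_{2^n r}$ over $\mathbb{F}_q$ is $$\Phi_{2^n r}(x) = \prod_{u\in U_A}\prod_{w\in\Omega(r)}\left(x^{2^{n-K}d_r} + \sum_{i=1}^{d_r} a_{K,i}\, x^{2^{n-K}(d_r-i)}\right),$$ where the vectors $(a_{K,1},\dots,a_{K,d_r})$ are those obtained in (i) for $n = K$. -/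

import Mathlib

open Polynomial

noncomputable section

namespace CyclotomicFactorization

/-- The set of primitive `k`-th roots of unity in the algebraic closure of `F`.
`U_n` is `primRoots F (2 ^ n)` and `Ω(r)` is `primRoots F r`. -/
def primRoots (F : Type*) [Field F] (k : ℕ) : Set (AlgebraicClosure F) :=
  {z | IsPrimitiveRoot z k}

/-- `S_{i,w} = S_i(w, w^q, …, w^{q^{d-1}})`, the `i`-th elementary symmetric polynomial evaluated
at the `d` conjugates of an element `w` of degree `d` over the field with `q` elements. -/
def conjSymm {L : Type*} [Field L] (q d i : ℕ) (w : L) : L :=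
  ((Multiset.range d).map fun j => w ^ q ^ j).esymm i

/-- The polynomial `∑_{i=0}^{d} u^i S_{i,w} x^{e (d - i)}`. -/
def twistedFactor {L : Type*} [Field L] (q d e : ℕ) (u w : L) : L[X] :=
  ∑ i ∈ Finset.range (d + 1), C (u ^ i * conjSymm q d i w) * X ^ (e * (d - i))

/-- The polynomial `x^{e d} + ∑_{i=1}^{d} a_i x^{e (d - i)}`. -/
def coeffPoly {F : Type*} [Field F] (d e : ℕ) (a : ℕ → F) : F[X] :=
  X ^ (e * d) + ∑ i ∈ Finset.Icc 1 d, C (a i) * X ^ (e * (d - i))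

/-- The system `∑_{i+j=2k} (-1)^j b_i b_j = a_k`, `1 ≤ k ≤ d`, where `0 ≤ i, j ≤ d` and `b_0 = 1`
(the leading coefficient): `b` is obtained from `a` by one step of the recurrence. -/
def RecurrenceStep {F : Type*} [Field F] (d : ℕ) (a b : ℕ → F) : Prop :=
  b 0 = 1 ∧ ∀ k ∈ Finset.Icc 1 d,
    ∑ p ∈ (Finset.range (d + 1) ×ˢ Finset.range (d + 1)).filter (fun p => p.1 + p.2 = 2 * k),
      (-1) ^ p.2 * b p.1 * b p.2 = a k

/-- `IsCoeffs q A d u w n a`: the coefficients `a = (a_{n,0} = 1, a_{n,1}, …, a_{n,d})` in `F` are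
obtained from the initial values `a_{A,k} = u^k S_{k,w}` by `n - A` steps of the recurrence.
Values `a i` with `i > d` are irrelevant. -/
inductive IsCoeffs {F : Type*} [Field F] (q A d : ℕ) (u w : AlgebraicClosure F) :
    ℕ → (ℕ → F) → Prop
  | init (a : ℕ → F) (h0 : a 0 = 1)
      (h : ∀ k ∈ Finset.Icc 1 d,
        algebraMap F (AlgebraicClosure F) (a k) = u ^ k * conjSymm q d k w) :
      IsCoeffs q A d u w A a
  | step (n : ℕ) (a b : ℕ → F) (ha : IsCoeffs q A d u w n a) (hb : RecurrenceStep d a b) :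
      IsCoeffs q A d u w (n + 1) b

/-- The polynomials in `S`, given with coefficients in the algebraic closure of `F`, all have
coefficients in `F`, are monic and irreducible over `F`, are finite in number, and the product of
these distinct polynomials is `P`. -/
def IsCompleteFactorization {F : Type*} [Field F] (P : F[X])
    (S : Set (AlgebraicClosure F)[X]) : Prop :=
  ∃ T : Finset F[X],
    (fun f : F[X] => f.map (algebraMap F (AlgebraicClosure F))) '' (T : Set F[X]) = S ∧
    (∀ f ∈ T, f.Monic ∧ Irreducible f) ∧
    P = ∏ f ∈ T, f

end CyclotomicFactorization

end

/-!
Over a field with `q` elements the minimal polynomial of a primitive `N`-th root of unity `z` is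
`∏ j, (X - z ^ q ^ j)`, of degree `ord_N(q)`. If `N = 2 ^ k * r` with `2 ^ k ∣ q - 1`, then
`z = -(u * w)` with `w` a primitive `r`-th root of unity and `u` fixed by the Frobenius, so the
conjugates of `z` are `-(u * w ^ q ^ j)` and its minimal polynomial has coefficients
`u ^ i * S_{i,w}`.

Lifting the exponent gives `ord_{2 ^ n r}(q) = 2 ^ (n - K) * d_r` with truncated subtraction. Let
`z` be a primitive `2 ^ n r`-th root of unity. If `n > K`, the degree is `2 ^ (n - K)` times the
one at level `K`, so the minimal polynomial of `z` is that of `z ^ 2 ^ (n - K)` with `X` replaced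
by `X ^ 2 ^ (n - K)`. If `A < n ≤ K`, then `d_r` is even, `z` and `z ^ 2` have the same degree
`d_r`, and the minimal polynomial `h` of `z ^ 2` is determined by the minimal polynomial `g` of `z`
through `h (X ^ 2) = g X * g (-X)`; comparing coefficients turns this into the recurrence.
-/

namespace CyclotomicFactorization

section CompleteFactorization

variable {F : Type*} [Field F]

open UniqueFactorizationMonoid in
theorem isCompleteFactorization_of_squarefree {P : F[X]} (hP : P.Monic) (hsq : Squarefree P) :
    IsCompleteFactorization P {f | ∃ z : AlgebraicClosure F, aeval z P = 0 ∧
      f = (minpoly F z).map (algebraMap F (AlgebraicClosure F))} := by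
  classical
  have hnodup := (squarefree_iff_nodup_normalizedFactors hP.ne_zero).1 hsq
  have hmem (g : F[X]) : g ∈ normalizedFactors P ↔ g.Monic ∧ Irreducible g ∧ g ∣ P := by
    rw [mem_normalizedFactors_iff' hP.ne_zero]
    constructor
    · rintro ⟨hirr, hnorm, hdvd⟩
      exact ⟨(normalize_eq_self_iff_monic hirr.ne_zero).1 hnorm, hirr, hdvd⟩
    · rintro ⟨hmon, hirr, hdvd⟩
      exact ⟨hirr, hmon.normalize_eq_self, hdvd⟩
  refine ⟨⟨normalizedFactors P, hnodup⟩, ?_, fun g hg => ?_, ?_⟩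
  · ext f
    constructor
    · rintro ⟨g, hg, rfl⟩
      obtain ⟨hmon, hirr, hdvd⟩ := (hmem g).1 hg
      obtain ⟨z, hz⟩ := IsAlgClosed.exists_aeval_eq_zero (AlgebraicClosure F) g
        (degree_pos_of_irreducible hirr).ne'
      exact ⟨z, aeval_eq_zero_of_dvd_aeval_eq_zero hdvd hz,
        by rw [← minpoly.eq_of_irreducible_of_monic hirr hz hmon]⟩
    · rintro ⟨z, hz, rfl⟩
      have hint : IsIntegral F z := Algebra.IsIntegral.isIntegral z
      exact ⟨minpoly F z,
        (hmem _).2 ⟨minpoly.monic hint, minpoly.irreducible hint, minpoly.dvd F z hz⟩, rfl⟩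
  · exact ⟨((hmem g).1 hg).1, ((hmem g).1 hg).2.1⟩
  · rw [Finset.prod_mk, Multiset.map_id', prod_normalizedFactors_eq hP.ne_zero,
      hP.normalize_eq_self]

theorem isCompleteFactorization_cyclotomic (N : ℕ) [NeZero (N : F)] :
    IsCompleteFactorization (cyclotomic N F) {f | ∃ z : AlgebraicClosure F, IsPrimitiveRoot z N ∧
      f = (minpoly F z).map (algebraMap F (AlgebraicClosure F))} := by
  have : NeZero (N : AlgebraicClosure F) :=
    NeZero.nat_of_injective (algebraMap F (AlgebraicClosure F)).injective
  have hroot (z : AlgebraicClosure F) :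
      aeval z (cyclotomic N F) = 0 ↔ IsPrimitiveRoot z N := by
    rw [← isRoot_cyclotomic_iff, ← map_cyclotomic N (algebraMap F (AlgebraicClosure F)),
      IsRoot, eval_map_algebraMap]
  simpa only [hroot] using
    isCompleteFactorization_of_squarefree (cyclotomic.monic N F) (squarefree_cyclotomic N F)

end CompleteFactorization

section Order

theorem orderOf_natCast_dvd_iff {q : ℕ} (hq : q ≠ 0) (N e : ℕ) :
    orderOf (q : ZMod N) ∣ e ↔ N ∣ q ^ e - 1 := by
  rw [orderOf_dvd_iff_pow_eq_one, ← Nat.cast_pow, ← Nat.cast_one, ZMod.natCast_eq_natCast_iff,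
    Nat.ModEq.comm, Nat.modEq_iff_dvd' (Nat.one_le_pow _ _ (Nat.pos_of_ne_zero hq))]

theorem orderOf_natCast_mul_dvd_iff {q N r : ℕ} (hq : q ≠ 0) (hNr : N.Coprime r) (e : ℕ) :
    orderOf (q : ZMod (N * r)) ∣ e ↔ N ∣ q ^ e - 1 ∧ orderOf (q : ZMod r) ∣ e := by
  rw [orderOf_natCast_dvd_iff hq, orderOf_natCast_dvd_iff hq]
  exact ⟨fun h => ⟨dvd_of_mul_right_dvd h, dvd_of_mul_left_dvd h⟩,
    fun h => hNr.mul_dvd_of_dvd_of_dvd h.1 h.2⟩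

theorem orderOf_natCast_mul_of_dvd_sub_one {q N r : ℕ} (hq : q ≠ 0) (hN : N ∣ q - 1)
    (hNr : N.Coprime r) : orderOf (q : ZMod (N * r)) = orderOf (q : ZMod r) := by
  refine Nat.dvd_right_iff_eq.1 fun e => (orderOf_natCast_mul_dvd_iff hq hNr e).trans ?_
  exact and_iff_right (hN.trans (Nat.sub_one_dvd_pow_sub_one q e))

theorem orderOf_natCast_ne_zero_of_coprime {q r : ℕ} (hr : r ≠ 0) (hqr : q.Coprime r) :
    orderOf (q : ZMod r) ≠ 0 := by
  have : NeZero r := ⟨hr⟩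
  rw [← ZMod.coe_unitOfCoprime q hqr, orderOf_units]
  exact (orderOf_pos _).ne'

theorem padicValNat_two_pow_sub_one {x n : ℕ} (hx : 1 < x) (h4 : 4 ∣ x - 1) (hn : n ≠ 0) :
    padicValNat 2 (x ^ n - 1) = padicValNat 2 (x - 1) + padicValNat 2 n := by
  have hxn : 1 < x ^ n := Nat.one_lt_pow hn hx
  have hcast (k : ℕ) (hk : 1 < x ^ k) :
      emultiplicity (2 : ℤ) ((x : ℤ) ^ k - 1) = padicValNat 2 (x ^ k - 1) := by
    rw [padicValNat_eq_emultiplicity (Nat.sub_pos_of_lt hk).ne', ← Int.natCast_emultiplicity,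
      Nat.cast_sub hk.le]
    simp
  have hlte := Int.two_pow_sub_pow' (x := x) (y := 1) n (by omega) (by omega)
  have hx' := hcast 1 (by simpa)
  rw [pow_one, pow_one] at hx'
  rw [one_pow, hcast n hxn, hx', show (2 : ℤ) = ((2 : ℕ) : ℤ) from rfl,
    Int.natCast_emultiplicity, ← padicValNat_eq_emultiplicity hn] at hlte
  exact_mod_cast hlte

theorem padicValNat_two_pow_sub_one_of_eq {q A m n : ℕ} (hq : q = 2 ^ A * m + 1) (hA : 2 ≤ A)
    (hm : Odd m) (hn : n ≠ 0) : padicValNat 2 (q ^ n - 1) = A + padicValNat 2 n := by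
  have hm0 : 0 < m := hm.pos
  have hq1 : 1 < q := by rw [hq]; exact Nat.lt_add_of_pos_left (by positivity)
  have hsub : q - 1 = 2 ^ A * m := by rw [hq, Nat.add_sub_cancel]
  rw [padicValNat_two_pow_sub_one hq1 (hsub ▸ (pow_dvd_pow 2 hA).mul_right m) hn, hsub,
    padicValNat.mul (by positivity) hm0.ne', padicValNat.prime_pow,
    padicValNat.eq_zero_of_not_dvd hm.not_two_dvd_nat, add_zero]

theorem two_pow_dvd_pow_sub_one_iff {x : ℕ} (hx : 1 < x) (h4 : 4 ∣ x - 1) (n f : ℕ) :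
    2 ^ n ∣ x ^ f - 1 ↔ 2 ^ (n - padicValNat 2 (x - 1)) ∣ f := by
  rcases eq_or_ne f 0 with rfl | hf
  · simp
  have hxf : x ^ f - 1 ≠ 0 := (Nat.sub_pos_of_lt (Nat.one_lt_pow hf hx)).ne'
  rw [padicValNat_dvd_iff_le hxf, padicValNat_dvd_iff_le hf, padicValNat_two_pow_sub_one hx h4 hf,
    tsub_le_iff_left]

theorem orderOf_natCast_two_pow_mul {q r : ℕ} (hq : 1 < q) (hr : Odd r)
    (hqr : q.Coprime r) (h4 : 4 ∣ q ^ orderOf (q : ZMod r) - 1) (n : ℕ) :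
    orderOf (q : ZMod (2 ^ n * r)) =
      2 ^ (n - padicValNat 2 (q ^ orderOf (q : ZMod r) - 1)) * orderOf (q : ZMod r) := by
  have hd := orderOf_natCast_ne_zero_of_coprime hr.pos.ne' hqr
  have hcop : Nat.Coprime (2 ^ n) r := (Nat.coprime_two_left.2 hr).pow_left n
  have hlift := two_pow_dvd_pow_sub_one_iff (Nat.one_lt_pow hd hq) h4 n
  simp only [← pow_mul] at hlift
  refine Nat.dvd_right_iff_eq.1 fun e =>
    (orderOf_natCast_mul_dvd_iff (by omega) hcop e).trans ⟨?_, fun h => ?_⟩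
  · rintro ⟨h, f, rfl⟩
    rw [mul_comm]
    exact Nat.mul_dvd_mul_left _ ((hlift f).1 h)
  · obtain ⟨f, rfl⟩ := dvd_of_mul_left_dvd h
    rw [mul_comm] at h
    exact ⟨(hlift f).2 (Nat.dvd_of_mul_dvd_mul_left (Nat.pos_of_ne_zero hd) h), dvd_mul_right _ f⟩

end Order

section FiniteField

variable {F : Type*} [Field F] [Fintype F]

theorem neZero_natCast_of_coprime_card {N : ℕ} (hN : (Fintype.card F).Coprime N) :
    NeZero (N : F) := by
  have h : IsCoprime ((Fintype.card F : ℕ) : F) (N : F) := hN.cast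
  rw [Nat.cast_card_eq_zero, isCoprime_zero_left] at h
  exact ⟨h.ne_zero⟩

variable {L : Type*} [Field L] [Algebra F L]

theorem frobeniusAlgHom_pow_apply (j : ℕ) (z : L) :
    (FiniteField.frobeniusAlgHom F L ^ j) z = z ^ Fintype.card F ^ j := by
  rw [AlgHom.coe_pow, FiniteField.coe_frobeniusAlgHom, pow_iterate]

variable (F) in
theorem neg_pow_card_pow (j : ℕ) (z : L) :
    (-z) ^ Fintype.card F ^ j = -z ^ Fintype.card F ^ j := by
  simp only [← frobeniusAlgHom_pow_apply, map_neg]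

theorem pow_card_pow_eq_self_iff {z : L} (hz : IsIntegral F z) (n : ℕ) :
    z ^ Fintype.card F ^ n = z ↔ (minpoly F z).natDegree ∣ n := by
  rw [(minpoly.irreducible hz).natDegree_dvd_iff_dvd_X_pow_card_pow_sub_X, minpoly.dvd_iff,
    Nat.card_eq_fintype_card, map_sub, map_pow, aeval_X, sub_eq_zero]

theorem natDegree_minpoly_of_isPrimitiveRoot {N : ℕ} (hN : N ≠ 0) {z : L}
    (hz : IsPrimitiveRoot z N) :
    (minpoly F z).natDegree = orderOf (Fintype.card F : ZMod N) := by
  have hint : IsIntegral F z := (hz.isIntegral (Nat.pos_of_ne_zero hN)).tower_top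
  have hz0 : z ≠ 0 := hz.ne_zero hN
  refine Nat.dvd_right_iff_eq.1 fun e => ?_
  have hpos : 1 ≤ Fintype.card F ^ e := Nat.one_le_pow _ _ Fintype.card_pos
  rw [← pow_card_pow_eq_self_iff hint, orderOf_natCast_dvd_iff Fintype.card_ne_zero,
    ← hz.pow_eq_one_iff_dvd, ← mul_eq_right₀ hz0, ← pow_succ, Nat.sub_add_cancel hpos]

theorem pow_card_pow_injOn {z : L} (hz : IsIntegral F z) :
    Set.InjOn (fun j => z ^ Fintype.card F ^ j) (Set.Iio (minpoly F z).natDegree) := by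
  have hle {i j : ℕ} (hij : i ≤ j) (hj : j < (minpoly F z).natDegree)
      (h : z ^ Fintype.card F ^ i = z ^ Fintype.card F ^ j) : i = j := by
    have hself : z ^ Fintype.card F ^ (j - i) = z := by
      apply (FiniteField.frobeniusAlgHom F L ^ i).injective
      simp only [AlgHom.toRingHom_eq_coe, RingHom.coe_coe, frobeniusAlgHom_pow_apply]
      rw [← pow_mul, ← pow_add, Nat.sub_add_cancel hij, h]
    have := Nat.eq_zero_of_dvd_of_lt ((pow_card_pow_eq_self_iff hz _).1 hself) (by omega)
    omega
  intro i hi j hj h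
  rcases le_total i j with hij | hij
  · exact hle hij hj h
  · exact (hle hij hi h.symm).symm

theorem map_minpoly_eq_prod {z : L} (hz : IsIntegral F z) :
    (minpoly F z).map (algebraMap F L) =
      ∏ j ∈ Finset.range (minpoly F z).natDegree, (X - C (z ^ Fintype.card F ^ j)) := by
  have hroot (j : ℕ) : aeval (z ^ Fintype.card F ^ j) (minpoly F z) = 0 := by
    have h := aeval_algHom_apply ((FiniteField.frobeniusAlgHom F L) ^ j) z (minpoly F z)
    rwa [minpoly.aeval, map_zero, frobeniusAlgHom_pow_apply] at h
  have hdvd : ∏ j ∈ Finset.range (minpoly F z).natDegree, (X - C (z ^ Fintype.card F ^ j)) ∣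
      (minpoly F z).map (algebraMap F L) := by
    refine Finset.prod_dvd_of_coprime (fun i hi j hj hij => ?_) fun j _ => ?_
    · have hne := (pow_card_pow_injOn hz).ne (by simpa using hi) (by simpa using hj) hij
      exact isCoprime_X_sub_C_of_isUnit_sub (sub_ne_zero.2 hne).isUnit
    · rw [dvd_iff_isRoot, IsRoot, eval_map_algebraMap, hroot]
  refine eq_of_monic_of_dvd_of_natDegree_le (monic_prod_X_sub_C _ _)
    ((minpoly.monic hz).map _) hdvd ?_
  rw [natDegree_map, natDegree_finsetProd_X_sub_C_eq_card, Finset.card_range]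

end FiniteField

section TwistedFactor

theorem twistedFactor_eq_prod {L : Type*} [Field L] (q d : ℕ) (u w : L) :
    twistedFactor q d 1 u w = ∏ j ∈ Finset.range d, (X + C (u * w ^ q ^ j)) := by
  have h := Multiset.prod_X_add_C_eq_sum_esymm ((Multiset.range d).map fun j => u • w ^ q ^ j)
  rw [Multiset.map_map, Multiset.card_map, Multiset.card_range] at h
  refine (Finset.sum_congr rfl fun i _ => ?_).trans h.symm
  rw [one_mul, conjSymm, ← smul_eq_mul (u ^ i), Multiset.pow_smul_esymm, Multiset.map_map]
  rfl

theorem twistedFactor_eq_map_minpoly {F : Type*} [Field F] [Fintype F] {L : Type*} [Field L]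
    [Algebra F L] {u w : L} (hu : u ^ Fintype.card F = u) (hint : IsIntegral F (-(u * w))) :
    twistedFactor (Fintype.card F) (minpoly F (-(u * w))).natDegree 1 u w =
      (minpoly F (-(u * w))).map (algebraMap F L) := by
  rw [twistedFactor_eq_prod, map_minpoly_eq_prod hint]
  refine Finset.prod_congr rfl fun j _ => ?_
  have hu' : u ^ Fintype.card F ^ j = u := by
    simpa only [pow_iterate] using
      (Function.IsFixedPt.iterate (f := (· ^ Fintype.card F)) hu j).eq
  rw [neg_pow_card_pow, mul_pow, hu', C_neg, sub_neg_eq_add]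

theorem twistedFactor_eq_expand {L : Type*} [Field L] (q d e : ℕ) (u w : L) :
    twistedFactor q d e u w = expand L e (twistedFactor q d 1 u w) := by
  simp [twistedFactor, map_sum, pow_mul]

end TwistedFactor

section PrimitiveRoots

theorem isPrimitiveRoot_mul_iff_of_coprime {M : Type*} [CommRing M] [IsDomain M] {a b : ℕ}
    (ha : a ≠ 0) (hb : b ≠ 0) (hab : a.Coprime b) {z : M} :
    IsPrimitiveRoot z (a * b) ↔ ∃ u w, IsPrimitiveRoot u a ∧ IsPrimitiveRoot w b ∧ z = u * w := by
  have hmul {u w : M} (hu : IsPrimitiveRoot u a) (hw : IsPrimitiveRoot w b) :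
      IsPrimitiveRoot (u * w) (a * b) := by
    rw [hu.eq_orderOf, hw.eq_orderOf] at hab ⊢
    rw [← (Commute.all u w).orderOf_mul_eq_mul_orderOf_of_coprime hab]
    exact IsPrimitiveRoot.orderOf (u * w)
  refine ⟨fun hz => ?_, fun ⟨u, w, hu, hw, hz⟩ => hz ▸ hmul hu hw⟩
  have hpos : 0 < a * b := by positivity
  have : NeZero (a * b) := ⟨hpos.ne'⟩
  have hu : IsPrimitiveRoot (z ^ b) a := hz.pow hpos (mul_comm a b)
  have hw : IsPrimitiveRoot (z ^ a) b := hz.pow hpos rfl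
  obtain ⟨i, -, hi⟩ := (hmul hu hw).eq_pow_of_pow_eq_one hz.pow_eq_one
  have hcop : i.Coprime (a * b) := ((hmul hu hw).pow_iff_coprime hpos i).1 (by rwa [hi])
  refine ⟨(z ^ b) ^ i, (z ^ a) ^ i, hu.pow_of_coprime i hcop.coprime_mul_right_right,
    hw.pow_of_coprime i hcop.coprime_mul_left_right, ?_⟩
  rw [← mul_pow, hi]

theorem isPrimitiveRoot_neg_iff {R : Type*} [CommRing R] {N : ℕ} (hN : 4 ∣ N) {u : R} :
    IsPrimitiveRoot (-u) N ↔ IsPrimitiveRoot u N := by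
  suffices h : ∀ v : R, IsPrimitiveRoot v N → IsPrimitiveRoot (-v) N from
    ⟨fun hu => neg_neg u ▸ h _ hu, h u⟩
  intro v hv
  refine ⟨?_, fun l hl => ?_⟩
  · rw [(even_iff_two_dvd.2 (dvd_trans (by norm_num) hN)).neg_pow, hv.pow_eq_one]
  · have h2 : N ∣ 2 * l := hv.dvd_of_pow_eq_one _ <| by
      rw [← (even_two_mul l).neg_pow, mul_comm, pow_mul, hl, one_pow]
    have hev : Even l := even_iff_two_dvd.2 (by have := hN.trans h2; omega)
    exact hv.dvd_of_pow_eq_one _ (by rwa [hev.neg_pow] at hl)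

theorem isPrimitiveRoot_pow_iff {M : Type*} [CommMonoid M] {N k : ℕ} (hN : N ≠ 0) (hk : k ≠ 0)
    (hkN : k.primeFactors ⊆ N.primeFactors) {y : M} :
    IsPrimitiveRoot (y ^ k) N ↔ IsPrimitiveRoot y (k * N) := by
  refine ⟨fun hy => ?_, fun hy => hy.pow (by positivity) rfl⟩
  set g := (orderOf y).gcd k
  have hg : g ∣ k := Nat.gcd_dvd_right _ _
  have hNg : N = orderOf y / g := hy.eq_orderOf.trans (orderOf_pow' y hk)
  have hcop : N.Coprime (k / g) := by
    rw [hNg]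
    exact Nat.coprime_div_gcd_div_gcd (Nat.gcd_pos_of_pos_right _ (Nat.pos_of_ne_zero hk))
  have hone : k / g = 1 := by
    by_contra hne
    obtain ⟨p, hp, hpk⟩ := Nat.exists_prime_and_dvd hne
    have hpN : p ∈ N.primeFactors :=
      hkN (Nat.mem_primeFactors.2 ⟨hp, hpk.trans (Nat.div_dvd_of_dvd hg), hk⟩)
    exact Nat.not_coprime_of_dvd_of_dvd hp.one_lt (Nat.dvd_of_mem_primeFactors hpN) hpk hcop
  have hgk : g = k := (Nat.eq_of_dvd_of_div_eq_one hg hone)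
  have hord : k * N = orderOf y := by
    rw [hNg, hgk, Nat.mul_div_cancel' (hgk ▸ Nat.gcd_dvd_left _ _)]
  exact hord ▸ IsPrimitiveRoot.orderOf y

end PrimitiveRoots

section TwistedFactorPrimitiveRoots

variable {F : Type*} [Field F] [Fintype F] {N r : ℕ}

theorem pow_card_eq_self_of_isPrimitiveRoot {M : Type*} [CommMonoid M] {u : M}
    (hN : N ∣ Fintype.card F - 1) (hu : IsPrimitiveRoot u N) : u ^ Fintype.card F = u := by
  rw [← Nat.sub_add_cancel (Fintype.card_pos (α := F)), pow_succ, (hu.pow_eq_one_iff_dvd _).2 hN,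
    one_mul]

variable {L : Type*} [Field L] [Algebra F L] {u w : L}

theorem twistedFactor_eq_map_minpoly_of_isPrimitiveRoot (hN : N ∣ Fintype.card F - 1)
    (hNr : N.Coprime r) (hr : r ≠ 0) (hu : IsPrimitiveRoot (-u) N) (hw : IsPrimitiveRoot w r) :
    twistedFactor (Fintype.card F) (orderOf (Fintype.card F : ZMod r)) 1 u w =
      (minpoly F (-(u * w))).map (algebraMap F L) := by
  have hN0 : N ≠ 0 := ne_zero_of_dvd_ne_zero (Nat.sub_pos_of_lt Fintype.one_lt_card).ne' hN
  have huq : u ^ Fintype.card F = u := by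
    have h := neg_pow_card_pow F 1 u
    rw [pow_one, pow_card_eq_self_of_isPrimitiveRoot hN hu] at h
    exact (neg_injective h).symm
  have hz : IsPrimitiveRoot (-(u * w)) (N * r) :=
    (isPrimitiveRoot_mul_iff_of_coprime hN0 hr hNr).2 ⟨-u, w, hu, hw, (neg_mul u w).symm⟩
  have hint : IsIntegral F (-(u * w)) := (hz.isIntegral (by positivity)).tower_top
  rw [← twistedFactor_eq_map_minpoly huq hint,
    natDegree_minpoly_of_isPrimitiveRoot (mul_ne_zero hN0 hr) hz,
    orderOf_natCast_mul_of_dvd_sub_one Fintype.card_ne_zero hN hNr]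

end TwistedFactorPrimitiveRoots

section Minpoly

variable {F : Type*} [Field F] {L : Type*} [Field L] [Algebra F L]

theorem eq_minpoly_of_natDegree_le {z : L} {f : F[X]} (hf : f.Monic) (hz : aeval z f = 0)
    (hdeg : f.natDegree ≤ (minpoly F z).natDegree) : f = minpoly F z :=
  eq_of_monic_of_dvd_of_natDegree_le (minpoly.monic ⟨f, hf, hz⟩) hf (minpoly.dvd F z hz) hdeg

theorem minpoly_eq_expand {z : L} {e : ℕ} (he : e ≠ 0) (hz : IsIntegral F z)
    (hdeg : (minpoly F z).natDegree = e * (minpoly F (z ^ e)).natDegree) :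
    minpoly F z = expand F e (minpoly F (z ^ e)) := by
  have hmonic := (minpoly.monic (hz.pow e)).expand (Nat.pos_of_ne_zero he)
  refine (eq_minpoly_of_natDegree_le hmonic ?_ ?_).symm
  · rw [expand_aeval, minpoly.aeval]
  · rw [natDegree_expand, hdeg, mul_comm]

end Minpoly

section CyclotomicExpand

variable {F : Type*} [Field F] [Fintype F]

theorem isCompleteFactorization_cyclotomic_expand {e N : ℕ}
    (hcop : (Fintype.card F).Coprime (e * N)) (heN : e.primeFactors ⊆ N.primeFactors)
    (hord : orderOf (Fintype.card F : ZMod (e * N)) = e * orderOf (Fintype.card F : ZMod N)) :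
    IsCompleteFactorization (cyclotomic (e * N) F)
      {f | ∃ y : AlgebraicClosure F, IsPrimitiveRoot y N ∧
        f = expand _ e ((minpoly F y).map (algebraMap F (AlgebraicClosure F)))} := by
  have := neZero_natCast_of_coprime_card hcop
  have h0 : e * N ≠ 0 := (NeZero.of_neZero_natCast F).ne
  obtain ⟨he, hN⟩ := mul_ne_zero_iff.1 h0
  have hmin {z : AlgebraicClosure F} (hz : IsPrimitiveRoot z (e * N)) :
      minpoly F z = expand F e (minpoly F (z ^ e)) :=
    minpoly_eq_expand he (Algebra.IsIntegral.isIntegral z) <| by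
      rw [natDegree_minpoly_of_isPrimitiveRoot h0 hz, hord,
        natDegree_minpoly_of_isPrimitiveRoot hN (hz.pow (Nat.pos_of_ne_zero h0) rfl)]
  convert isCompleteFactorization_cyclotomic (F := F) (e * N) using 1
  ext f
  constructor
  · rintro ⟨y, hy, rfl⟩
    obtain ⟨z, rfl⟩ := IsAlgClosed.exists_pow_nat_eq y (Nat.pos_of_ne_zero he)
    have hz := (isPrimitiveRoot_pow_iff hN he heN).1 hy
    exact ⟨z, hz, by rw [hmin hz, map_expand]⟩
  · rintro ⟨z, hz, rfl⟩
    exact ⟨z ^ e, (isPrimitiveRoot_pow_iff hN he heN).2 hz, by rw [hmin hz, map_expand]⟩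

theorem isCompleteFactorization_twistedFactor {e N r : ℕ} (hN : N ∣ Fintype.card F - 1)
    (hNr : N.Coprime r) (hcop : (Fintype.card F).Coprime (e * (N * r)))
    (heN : e.primeFactors ⊆ N.primeFactors)
    (hord : orderOf (Fintype.card F : ZMod (e * (N * r))) =
      e * orderOf (Fintype.card F : ZMod r)) :
    IsCompleteFactorization (cyclotomic (e * (N * r)) F)
      {f | ∃ u, IsPrimitiveRoot (-u) N ∧ ∃ w ∈ primRoots F r,
        f = twistedFactor (Fintype.card F) (orderOf (Fintype.card F : ZMod r)) e u w} := by
  have hordN : orderOf (Fintype.card F : ZMod (N * r)) = orderOf (Fintype.card F : ZMod r) :=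
    orderOf_natCast_mul_of_dvd_sub_one Fintype.card_ne_zero hN hNr
  have := neZero_natCast_of_coprime_card hcop
  have h0 : NeZero (e * (N * r)) := .of_neZero_natCast F
  have hNr0 : N * r ≠ 0 := right_ne_zero_of_mul h0.ne
  obtain ⟨hN0, hr0⟩ := mul_ne_zero_iff.1 hNr0
  have hfactor {u w : AlgebraicClosure F} (hu : IsPrimitiveRoot (-u) N)
      (hw : IsPrimitiveRoot w r) :
      twistedFactor (Fintype.card F) (orderOf (Fintype.card F : ZMod r)) e u w =
        expand _ e ((minpoly F (-u * w)).map (algebraMap F (AlgebraicClosure F))) := by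
    rw [twistedFactor_eq_expand, twistedFactor_eq_map_minpoly_of_isPrimitiveRoot hN hNr hr0 hu hw,
      neg_mul]
  convert isCompleteFactorization_cyclotomic_expand hcop
    (heN.trans (Nat.primeFactors_mono (dvd_mul_right N r) hNr0))
    (by rw [hord, hordN]) using 1
  ext f
  constructor
  · rintro ⟨u, hu, w, hw, rfl⟩
    exact ⟨-u * w, (isPrimitiveRoot_mul_iff_of_coprime hN0 hr0 hNr).2 ⟨-u, w, hu, hw, rfl⟩,
      hfactor hu hw⟩
  · rintro ⟨y, hy, rfl⟩
    obtain ⟨u, w, hu, hw, rfl⟩ := (isPrimitiveRoot_mul_iff_of_coprime hN0 hr0 hNr).1 hy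
    rw [← neg_neg u] at hu ⊢
    exact ⟨-u, hu, w, hw, (hfactor hu hw).symm⟩

end CyclotomicExpand

section TwoPow

theorem primeFactors_two_pow_subset (e : ℕ) {k : ℕ} (hk : k ≠ 0) :
    (2 ^ e).primeFactors ⊆ (2 ^ k).primeFactors := by
  rw [Nat.primeFactors_pow 2 hk]
  rcases eq_or_ne e 0 with rfl | he
  · simp
  · rw [Nat.primeFactors_pow 2 he]

variable {F : Type*} [Field F] [Fintype F] {r k n : ℕ}

theorem isCompleteFactorization_twistedFactor_two_mul (hq : Odd (Fintype.card F)) (hr : Odd r)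
    (hcop : (Fintype.card F).Coprime r) :
    IsCompleteFactorization (cyclotomic (2 * r) F)
      {f | ∃ w ∈ primRoots F r,
        f = twistedFactor (Fintype.card F) (orderOf (Fintype.card F : ZMod r)) 1 1 w} := by
  have hN : 2 ∣ Fintype.card F - 1 := (hq.tsub_odd odd_one).two_dvd
  have hcop2 : (Fintype.card F).Coprime (1 * (2 * r)) := by
    rw [one_mul]
    exact (Nat.coprime_two_right.2 hq).mul_right hcop
  have h2r : Nat.Coprime 2 r := Nat.coprime_two_left.2 hr
  have hneg (u : AlgebraicClosure F) : IsPrimitiveRoot (-u) 2 ↔ u = 1 := by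
    have : NeZero ((2 : ℕ) : F) := neZero_natCast_of_coprime_card (Nat.coprime_two_right.2 hq)
    have : NeZero ((2 : ℕ) : AlgebraicClosure F) :=
      NeZero.nat_of_injective (algebraMap F (AlgebraicClosure F)).injective
    refine ⟨fun hu => neg_injective hu.eq_neg_one_of_two_right, ?_⟩
    rintro rfl
    obtain ⟨ζ, hζ⟩ := HasEnoughRootsOfUnity.exists_primitiveRoot (AlgebraicClosure F) 2
    rwa [← hζ.eq_neg_one_of_two_right]
  have h := isCompleteFactorization_twistedFactor hN h2r hcop2 (by simp)
    (by rw [one_mul, one_mul, orderOf_natCast_mul_of_dvd_sub_one Fintype.card_ne_zero hN h2r])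
  simpa only [one_mul, hneg, exists_eq_left] using h

theorem isCompleteFactorization_twistedFactor_of_dvd_sub_one {N : ℕ} (h4 : 4 ∣ N)
    (hN : N ∣ Fintype.card F - 1) (hNr : N.Coprime r)
    (hcop : (Fintype.card F).Coprime (N * r)) :
    IsCompleteFactorization (cyclotomic (N * r) F)
      {f | ∃ u ∈ primRoots F N, ∃ w ∈ primRoots F r,
        f = twistedFactor (Fintype.card F) (orderOf (Fintype.card F : ZMod r)) 1 u w} := by
  rw [← one_mul (N * r)] at hcop ⊢
  have h := isCompleteFactorization_twistedFactor hN hNr hcop (by simp)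
    (by rw [one_mul, one_mul, orderOf_natCast_mul_of_dvd_sub_one Fintype.card_ne_zero hN hNr])
  simp only [isPrimitiveRoot_neg_iff h4] at h
  exact h

theorem isCompleteFactorization_twistedFactor_two_pow (hk : 2 ≤ k) (hkn : k ≤ n)
    (hkq : 2 ^ k ∣ Fintype.card F - 1) (hr : Odd r)
    (hcop : (Fintype.card F).Coprime (2 ^ n * r))
    (hord : orderOf (Fintype.card F : ZMod (2 ^ n * r)) =
      2 ^ (n - k) * orderOf (Fintype.card F : ZMod r)) :
    IsCompleteFactorization (cyclotomic (2 ^ n * r) F)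
      {f | ∃ u ∈ primRoots F (2 ^ k), ∃ w ∈ primRoots F r,
        f = twistedFactor (Fintype.card F) (orderOf (Fintype.card F : ZMod r))
          (2 ^ (n - k)) u w} := by
  rw [← pow_sub_mul_pow 2 hkn, mul_assoc] at hcop hord ⊢
  have h := isCompleteFactorization_twistedFactor hkq ((Nat.coprime_two_left.2 hr).pow_left k) hcop
    (primeFactors_two_pow_subset _ (by omega)) hord
  simp only [isPrimitiveRoot_neg_iff (pow_dvd_pow 2 hk)] at h
  exact h

end TwoPow

section CoeffPoly

variable {F : Type*} [Field F] {d : ℕ} {a b : ℕ → F}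

theorem coeffPoly_eq_expand (d e : ℕ) (a : ℕ → F) :
    coeffPoly d e a = expand F e (coeffPoly d 1 a) := by
  simp [coeffPoly, map_sum, pow_mul]

theorem map_coeffPoly {L : Type*} [Field L] (φ : F →+* L) (d e : ℕ) (a : ℕ → F) :
    (coeffPoly d e a).map φ = coeffPoly d e (φ ∘ a) := by
  simp [coeffPoly, Polynomial.map_sum]

theorem coeffPoly_eq_sum (d e : ℕ) (ha : a 0 = 1) :
    coeffPoly d e a = ∑ i ∈ Finset.range (d + 1), C (a i) * X ^ (e * (d - i)) := by
  rw [Finset.range_eq_Ico, Finset.sum_eq_sum_Ico_succ_bot (Nat.succ_pos d), ha, C_1, one_mul]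
  rfl

theorem twistedFactor_eq_coeffPoly {L : Type*} [Field L] (q d e : ℕ) (u w : L) :
    twistedFactor q d e u w = coeffPoly d e fun i => u ^ i * conjSymm q d i w := by
  rw [coeffPoly_eq_sum d e (by simp [conjSymm, Multiset.esymm]), twistedFactor]

theorem degree_coeffPoly_tail_lt (d : ℕ) (a : ℕ → F) :
    (∑ i ∈ Finset.Icc 1 d, C (a i) * X ^ (1 * (d - i))).degree <
      ((1 * d : ℕ) : WithBot ℕ) := by
  refine (degree_sum_le _ _).trans_lt ((Finset.sup_lt_iff (WithBot.bot_lt_coe _)).2 fun i hi => ?_)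
  refine (degree_C_mul_X_pow_le _ _).trans_lt ?_
  have := Finset.mem_Icc.1 hi
  exact_mod_cast (by omega : 1 * (d - i) < 1 * d)

theorem monic_coeffPoly (d : ℕ) (a : ℕ → F) : (coeffPoly d 1 a).Monic :=
  monic_X_pow_add (degree_coeffPoly_tail_lt d a)

theorem natDegree_coeffPoly (d : ℕ) (a : ℕ → F) : (coeffPoly d 1 a).natDegree = d := by
  rw [coeffPoly, natDegree_add_eq_left_of_degree_lt, natDegree_X_pow, one_mul]
  rw [degree_X_pow]
  exact degree_coeffPoly_tail_lt d a

theorem coeff_coeffPoly_sub (a : ℕ → F) {k : ℕ} (hk : k ∈ Finset.Icc 1 d) :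
    (coeffPoly d 1 a).coeff (d - k) = a k := by
  have hkd := Finset.mem_Icc.1 hk
  rw [coeffPoly, coeff_add, coeff_X_pow, if_neg (by omega), zero_add, finsetSum_coeff,
    Finset.sum_eq_single_of_mem k hk fun i hi hik => ?_]
  · simp
  · have := Finset.mem_Icc.1 hi
    rw [coeff_C_mul_X_pow, if_neg (by omega)]

theorem coeffPoly_inj_iff :
    coeffPoly d 1 a = coeffPoly d 1 b ↔ ∀ k ∈ Finset.Icc 1 d, a k = b k := by
  refine ⟨fun h k hk => ?_, fun h => ?_⟩
  · rw [← coeff_coeffPoly_sub a hk, h, coeff_coeffPoly_sub b hk]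
  · rw [coeffPoly, coeffPoly, Finset.sum_congr rfl fun k hk => by rw [h k hk]]

theorem coeffPoly_coeff {g : F[X]} (hg : g.Monic) (hd : g.natDegree = d) :
    coeffPoly d 1 (fun i => g.coeff (d - i)) = g := by
  conv_rhs => rw [hg.as_sum, hd]
  rw [coeffPoly, one_mul]
  congr 1
  refine Finset.sum_nbij' (d - ·) (d - ·) ?_ ?_ ?_ ?_ ?_ <;> intro i hi <;>
    simp only [Finset.mem_Icc, Finset.mem_range, one_mul] at hi ⊢ <;> omega

theorem coeffPoly_eq_iff_of_twistedFactor_eq_map {L : Type*} [Field L] [Algebra F L] {q : ℕ}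
    {u w : L} {f : F[X]} (hf : twistedFactor q d 1 u w = f.map (algebraMap F L)) :
    coeffPoly d 1 a = f ↔
      ∀ k ∈ Finset.Icc 1 d, algebraMap F L (a k) = u ^ k * conjSymm q d k w := by
  rw [← (map_injective _ (algebraMap F L).injective).eq_iff, ← hf, map_coeffPoly,
    twistedFactor_eq_coeffPoly, coeffPoly_inj_iff]
  rfl

end CoeffPoly

section Graeffe

/-- The Dandelin–Graeffe transform of a polynomial `g`: the polynomial whose value at `x ^ 2` is
`g x * g (-x)`, so that its roots are the squares of the roots of `g`. It is normalized without a
sign, hence monic for monic `g` of even degree. -/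
noncomputable def graeffe {R : Type*} [CommRing R] (g : R[X]) : R[X] :=
  contract 2 (g * g.comp (-X))

variable {R : Type*} [CommRing R]

theorem coeff_mul_comp_neg_X (g h : R[X]) (n : ℕ) :
    (g * h.comp (-X)).coeff n =
      ∑ p ∈ Finset.HasAntidiagonal.antidiagonal n, (-1) ^ p.2 * g.coeff p.1 * h.coeff p.2 := by
  have hX : (-X : R[X]) = C (-1) * X := by simp
  rw [coeff_mul]
  refine Finset.sum_congr rfl fun p _ => ?_
  rw [hX, comp_C_mul_X_coeff]
  ring

theorem expand_graeffe (g : R[X]) : expand R 2 (graeffe g) = g * g.comp (-X) := by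
  ext n
  rw [coeff_expand two_pos]
  split_ifs with hn
  · rw [graeffe, coeff_contract two_ne_zero, Nat.div_mul_cancel hn]
  · -- In odd degree the terms for `(i, j)` and `(j, i)` cancel.
    rw [coeff_mul_comp_neg_X]
    refine (Finset.sum_involution (fun p _ => p.swap) ?_ ?_ ?_ fun p _ => p.swap_swap).symm
    · rintro ⟨i, j⟩ hp
      have hij : i + j = n := Finset.HasAntidiagonal.mem_antidiagonal.1 hp
      have hpar : (-1 : R) ^ i = -(-1) ^ j := by
        rcases Nat.even_or_odd j with hj | hj
        · rw [hj.neg_one_pow, Odd.neg_one_pow (by grind)]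
        · rw [hj.neg_one_pow, Even.neg_one_pow (by grind), neg_neg]
      rw [Prod.swap_prod_mk, hpar]
      ring
    · rintro ⟨i, j⟩ hp - heq
      have hij : i + j = n := Finset.HasAntidiagonal.mem_antidiagonal.1 hp
      have hji : j = i := congrArg Prod.fst heq
      exact hn ⟨i, by rw [← hij, hji, two_mul]⟩
    · exact fun p hp => Finset.HasAntidiagonal.swap_mem_antidiagonal.2 hp

theorem aeval_sq_graeffe {S : Type*} [CommRing S] [Algebra R S] (g : R[X]) (z : S) :
    aeval (z ^ 2) (graeffe g) = aeval z g * aeval (-z) g := by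
  rw [← expand_aeval, expand_graeffe, map_mul, aeval_comp, map_neg, aeval_X]

theorem monic_comp_neg_X {g : R[X]} (hg : g.Monic) (hd : Even g.natDegree) :
    (g.comp (-X)).Monic := by
  simpa only [hd.neg_one_pow, one_mul] using hg.neg_one_pow_natDegree_mul_comp_neg_X

theorem monic_graeffe {g : R[X]} (hg : g.Monic) (hd : Even g.natDegree) : (graeffe g).Monic := by
  rw [← monic_expand_iff two_pos, expand_graeffe]
  exact hg.mul (monic_comp_neg_X hg hd)

theorem natDegree_graeffe {g : R[X]} (hg : g.Monic) (hd : Even g.natDegree) :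
    (graeffe g).natDegree = g.natDegree := by
  have h := congrArg natDegree (expand_graeffe g)
  rw [natDegree_expand, hg.natDegree_mul (monic_comp_neg_X hg hd),
    natDegree_eq_of_degree_eq degree_comp_neg_X] at h
  omega

theorem graeffe_minpoly {F L : Type*} [Field F] [Field L] [Algebra F L] {y : L}
    (hy : IsIntegral F y) (heven : Even (minpoly F y).natDegree)
    (hdeg : (minpoly F (y ^ 2)).natDegree = (minpoly F y).natDegree) :
    graeffe (minpoly F y) = minpoly F (y ^ 2) :=
  eq_minpoly_of_natDegree_le (monic_graeffe (minpoly.monic hy) heven)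
    (by rw [aeval_sq_graeffe, minpoly.aeval, zero_mul])
    (by rw [natDegree_graeffe (minpoly.monic hy) heven, hdeg])

end Graeffe

section RecurrenceStep

variable {F : Type*} [Field F] {d : ℕ} {a b : ℕ → F}

theorem coeff_graeffe_coeffPoly (hd : Even d) (hb : b 0 = 1) {k : ℕ} (hk : k ≤ d) :
    (graeffe (coeffPoly d 1 b)).coeff (d - k) =
      ∑ p ∈ (Finset.range (d + 1) ×ˢ Finset.range (d + 1)).filter (fun p => p.1 + p.2 = 2 * k),
        (-1) ^ p.2 * b p.1 * b p.2 := by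
  have hcomp : (coeffPoly d 1 b).comp (-X) =
      ∑ j ∈ Finset.range (d + 1), C ((-1) ^ j * b j) * X ^ (d - j) := by
    rw [coeffPoly_eq_sum d 1 hb, sum_comp]
    refine Finset.sum_congr rfl fun j hj => ?_
    have hjd : j ≤ d := by grind
    have hpar : (-1 : F[X]) ^ (d - j) = (-1) ^ j := by
      rcases Nat.even_or_odd j with hj | hj
      · rw [hj.neg_one_pow, Even.neg_one_pow (by grind)]
      · rw [hj.neg_one_pow, Odd.neg_one_pow (by grind)]
    simp only [mul_comp, C_comp, pow_comp, X_comp, one_mul, C_mul, C_pow, C_neg, C_1]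
    rw [neg_pow, hpar]
    ring
  rw [graeffe, coeff_contract two_ne_zero, hcomp, coeffPoly_eq_sum d 1 hb, Finset.sum_mul_sum,
    ← Finset.sum_product', finsetSum_coeff, Finset.sum_filter]
  refine Finset.sum_congr rfl fun p hp => ?_
  rw [Finset.mem_product, Finset.mem_range, Finset.mem_range] at hp
  rw [one_mul, mul_mul_mul_comm, ← C_mul, ← pow_add, coeff_C_mul_X_pow]
  refine if_congr (by omega) (by ring) rfl

theorem recurrenceStep_iff (hd : Even d) :
    RecurrenceStep d a b ↔ b 0 = 1 ∧ graeffe (coeffPoly d 1 b) = coeffPoly d 1 a := by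
  have hdeg : Even (coeffPoly d 1 b).natDegree := by rwa [natDegree_coeffPoly]
  have hg : coeffPoly d 1 (fun i => (graeffe (coeffPoly d 1 b)).coeff (d - i)) =
      graeffe (coeffPoly d 1 b) :=
    coeffPoly_coeff (monic_graeffe (monic_coeffPoly d b) hdeg)
      (by rw [natDegree_graeffe (monic_coeffPoly d b) hdeg, natDegree_coeffPoly])
  refine and_congr_right fun hb => ?_
  rw [← hg, coeffPoly_inj_iff]
  refine forall₂_congr fun k hk => ?_
  rw [coeff_graeffe_coeffPoly hd hb (Finset.mem_Icc.1 hk).2]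

variable {L : Type*} [Field L] [Algebra F L]

theorem RecurrenceStep.exists_sq_eq_of_aeval_eq_zero [IsAlgClosed L] (hd : Even d)
    (hab : RecurrenceStep d a b) {z : L} (hz : aeval z (coeffPoly d 1 a) = 0) :
    ∃ y, y ^ 2 = z ∧ aeval y (coeffPoly d 1 b) = 0 := by
  obtain ⟨y, rfl⟩ := IsAlgClosed.exists_pow_nat_eq z two_pos
  rw [← ((recurrenceStep_iff hd).1 hab).2, aeval_sq_graeffe, mul_eq_zero] at hz
  rcases hz with hy | hy
  · exact ⟨y, rfl, hy⟩
  · exact ⟨-y, neg_sq y, hy⟩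

theorem exists_recurrenceStep_of_coeffPoly_eq_minpoly_sq {y : L} (hy : IsIntegral F y)
    (hd : Even d) (hdy : (minpoly F y).natDegree = d) (hdy2 : (minpoly F (y ^ 2)).natDegree = d)
    (ha : coeffPoly d 1 a = minpoly F (y ^ 2)) :
    ∃ b, RecurrenceStep d a b ∧ coeffPoly d 1 b = minpoly F y := by
  have hb := coeffPoly_coeff (minpoly.monic hy) hdy
  refine ⟨_, (recurrenceStep_iff hd).2 ⟨?_, ?_⟩, hb⟩
  · simpa [← hdy] using (minpoly.monic hy).coeff_natDegree
  · rw [hb, ha, graeffe_minpoly hy (hdy ▸ hd) (hdy2.trans hdy.symm)]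

end RecurrenceStep

section RecurrencePrimitiveRoots

theorem isPrimitiveRoot_sq_iff {M : Type*} [CommMonoid M] {N : ℕ} (hN : N ≠ 0) (h2 : 2 ∣ N)
    {y : M} : IsPrimitiveRoot (y ^ 2) N ↔ IsPrimitiveRoot y (2 * N) :=
  isPrimitiveRoot_pow_iff hN two_ne_zero (Nat.primeFactors_mono h2 hN)

variable {F : Type*} [Field F] [Fintype F] {L : Type*} [Field L] [Algebra F L]
  {N d : ℕ} {a b : ℕ → F}

theorem RecurrenceStep.exists_isPrimitiveRoot [IsAlgClosed L] (hab : RecurrenceStep d a b)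
    (hd : Even d) (hN : N ≠ 0) (h2 : 2 ∣ N)
    (hord : orderOf (Fintype.card F : ZMod (2 * N)) = d) {z : L} (hz : IsPrimitiveRoot z N)
    (ha : coeffPoly d 1 a = minpoly F z) :
    ∃ y : L, IsPrimitiveRoot y (2 * N) ∧ coeffPoly d 1 b = minpoly F y := by
  obtain ⟨y, rfl, hy⟩ := hab.exists_sq_eq_of_aeval_eq_zero hd (ha ▸ minpoly.aeval F z)
  have hyN : IsPrimitiveRoot y (2 * N) := (isPrimitiveRoot_sq_iff hN h2).1 hz
  refine ⟨y, hyN, eq_minpoly_of_natDegree_le (monic_coeffPoly d b) hy ?_⟩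
  rw [natDegree_coeffPoly, natDegree_minpoly_of_isPrimitiveRoot (by positivity) hyN, hord]

theorem exists_recurrenceStep_of_isPrimitiveRoot (hd : Even d) (hN : N ≠ 0)
    (hord : orderOf (Fintype.card F : ZMod N) = d)
    (hord2 : orderOf (Fintype.card F : ZMod (2 * N)) = d) {y : L} (hy : IsPrimitiveRoot y (2 * N))
    (ha : coeffPoly d 1 a = minpoly F (y ^ 2)) :
    ∃ b, RecurrenceStep d a b ∧ coeffPoly d 1 b = minpoly F y := by
  have hy2 : IsPrimitiveRoot (y ^ 2) N := hy.pow (by positivity) rfl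
  refine exists_recurrenceStep_of_coeffPoly_eq_minpoly_sq
    (hy.isIntegral (by positivity)).tower_top hd ?_ ?_ ha
  · rw [natDegree_minpoly_of_isPrimitiveRoot (by positivity) hy, hord2]
  · rw [natDegree_minpoly_of_isPrimitiveRoot hN hy2, hord]

end RecurrencePrimitiveRoots

section IsCoeffs

theorem IsCoeffs.le {F : Type*} [Field F] {q A d n : ℕ} {u w : AlgebraicClosure F} {a : ℕ → F}
    (ha : IsCoeffs q A d u w n a) : A ≤ n := by
  induction ha with
  | init => rfl
  | step _ _ _ _ _ ih => exact ih.trans (Nat.le_succ _)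

theorem isPrimitiveRoot_two_pow_mul_iff {F : Type*} [Field F] {A r : ℕ} (hA : 2 ≤ A) (hr : Odd r)
    {z : AlgebraicClosure F} :
    IsPrimitiveRoot z (2 ^ A * r) ↔
      ∃ u ∈ primRoots F (2 ^ A), ∃ w ∈ primRoots F r, z = -(u * w) := by
  rw [isPrimitiveRoot_mul_iff_of_coprime (by positivity) hr.pos.ne'
    ((Nat.coprime_two_left.2 hr).pow_left A), neg_surjective.exists]
  simp only [isPrimitiveRoot_neg_iff (pow_dvd_pow 2 hA), neg_mul, exists_and_left]
  rfl

variable {F : Type*} [Field F] [Fintype F] {A r d n : ℕ} {u w : AlgebraicClosure F} {a : ℕ → F}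

theorem twistedFactor_eq_map_minpoly_of_mem_primRoots (hA : 2 ≤ A)
    (hAq : 2 ^ A ∣ Fintype.card F - 1) (hr : Odd r)
    (hd : orderOf (Fintype.card F : ZMod (2 ^ A * r)) = d)
    (hu : u ∈ primRoots F (2 ^ A)) (hw : w ∈ primRoots F r) :
    twistedFactor (Fintype.card F) d 1 u w =
      (minpoly F (-(u * w))).map (algebraMap F (AlgebraicClosure F)) := by
  have hcop : Nat.Coprime (2 ^ A) r := (Nat.coprime_two_left.2 hr).pow_left A
  rw [← hd, orderOf_natCast_mul_of_dvd_sub_one Fintype.card_ne_zero hAq hcop]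
  exact twistedFactor_eq_map_minpoly_of_isPrimitiveRoot hAq hcop hr.pos.ne'
    ((isPrimitiveRoot_neg_iff (pow_dvd_pow 2 hA)).2 hu) hw

theorem exists_isCoeffs_initial (hA : 2 ≤ A) (hAq : 2 ^ A ∣ Fintype.card F - 1) (hr : Odd r)
    (hd : orderOf (Fintype.card F : ZMod (2 ^ A * r)) = d)
    (hu : u ∈ primRoots F (2 ^ A)) (hw : w ∈ primRoots F r) :
    ∃ a, IsCoeffs (Fintype.card F) A d u w A a ∧ coeffPoly d 1 a = minpoly F (-(u * w)) := by
  have htwist := twistedFactor_eq_map_minpoly_of_mem_primRoots hA hAq hr hd hu hw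
  have hz : IsPrimitiveRoot (-(u * w)) (2 ^ A * r) :=
    (isPrimitiveRoot_two_pow_mul_iff hA hr).2 ⟨u, hu, w, hw, rfl⟩
  have hmonic : (minpoly F (-(u * w))).Monic := minpoly.monic (Algebra.IsIntegral.isIntegral _)
  have hdeg : (minpoly F (-(u * w))).natDegree = d :=
    (natDegree_minpoly_of_isPrimitiveRoot (mul_ne_zero (by positivity) hr.pos.ne') hz).trans hd
  have ha := coeffPoly_coeff hmonic hdeg
  refine ⟨_, .init _ ?_ ((coeffPoly_eq_iff_of_twistedFactor_eq_map htwist).1 ha), ha⟩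
  simpa [← hdeg] using hmonic.coeff_natDegree

theorem IsCoeffs.exists_coeffPoly_eq_minpoly (ha : IsCoeffs (Fintype.card F) A d u w n a)
    (hA : 2 ≤ A) (hAq : 2 ^ A ∣ Fintype.card F - 1) (hr : Odd r) (hd : Even d)
    (hord : ∀ j ∈ Set.Icc A n, orderOf (Fintype.card F : ZMod (2 ^ j * r)) = d)
    (hu : u ∈ primRoots F (2 ^ A)) (hw : w ∈ primRoots F r) :
    ∃ z : AlgebraicClosure F, IsPrimitiveRoot z (2 ^ n * r) ∧ coeffPoly d 1 a = minpoly F z := by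
  induction ha with
  | init a _ h =>
    have htwist := twistedFactor_eq_map_minpoly_of_mem_primRoots hA hAq hr
      (hord A (Set.left_mem_Icc.2 le_rfl)) hu hw
    exact ⟨-(u * w), (isPrimitiveRoot_two_pow_mul_iff hA hr).2 ⟨u, hu, w, hw, rfl⟩,
      (coeffPoly_eq_iff_of_twistedFactor_eq_map htwist).2 h⟩
  | step n a b ha hab ih =>
    have hAn : A ≤ n := ha.le
    obtain ⟨z, hz, haz⟩ := ih fun j hj => hord j ⟨hj.1, hj.2.trans n.le_succ⟩
    have hordn := hord (n + 1) ⟨by omega, le_rfl⟩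
    rw [pow_succ', mul_assoc] at hordn ⊢
    have h2 : 2 ∣ 2 ^ n * r := (dvd_pow_self 2 (by omega)).mul_right r
    exact hab.exists_isPrimitiveRoot hd (mul_ne_zero (by positivity) hr.pos.ne') h2 hordn hz haz

theorem exists_isCoeffs_of_isPrimitiveRoot (hA : 2 ≤ A) (hAq : 2 ^ A ∣ Fintype.card F - 1)
    (hr : Odd r) (hd : Even d) (hAn : A ≤ n)
    (hord : ∀ j ∈ Set.Icc A n, orderOf (Fintype.card F : ZMod (2 ^ j * r)) = d)
    {z : AlgebraicClosure F} (hz : IsPrimitiveRoot z (2 ^ n * r)) :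
    ∃ u ∈ primRoots F (2 ^ A), ∃ w ∈ primRoots F r, ∃ a,
      IsCoeffs (Fintype.card F) A d u w n a ∧ coeffPoly d 1 a = minpoly F z := by
  induction n, hAn using Nat.le_induction generalizing z with
  | base =>
    obtain ⟨u, hu, w, hw, rfl⟩ := (isPrimitiveRoot_two_pow_mul_iff hA hr).1 hz
    exact ⟨u, hu, w, hw, exists_isCoeffs_initial hA hAq hr (hord A ⟨le_rfl, le_rfl⟩) hu hw⟩
  | succ n hAn ih =>
    have hordn := hord (n + 1) ⟨by omega, le_rfl⟩
    have h0 : 2 ^ n * r ≠ 0 := mul_ne_zero (by positivity) hr.pos.ne'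
    rw [pow_succ', mul_assoc] at hordn hz
    obtain ⟨u, hu, w, hw, a, ha, haz⟩ :=
      ih (fun j hj => hord j ⟨hj.1, hj.2.trans n.le_succ⟩) (hz.pow (by positivity) rfl)
    obtain ⟨b, hab, hb⟩ := exists_recurrenceStep_of_isPrimitiveRoot hd h0
      (hord n ⟨hAn, n.le_succ⟩) hordn hz haz
    exact ⟨u, hu, w, hw, b, .step n a b ha hab, hb⟩

theorem IsCoeffs.exists_recurrenceStep (ha : IsCoeffs (Fintype.card F) A d u w n a)
    (hA : 2 ≤ A) (hAq : 2 ^ A ∣ Fintype.card F - 1) (hr : Odd r) (hd : Even d)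
    (hord : ∀ j ∈ Set.Icc A (n + 1), orderOf (Fintype.card F : ZMod (2 ^ j * r)) = d)
    (hu : u ∈ primRoots F (2 ^ A)) (hw : w ∈ primRoots F r) :
    ∃ b, RecurrenceStep d a b := by
  have hAn : A ≤ n := ha.le
  obtain ⟨z, hz, haz⟩ := ha.exists_coeffPoly_eq_minpoly hA hAq hr hd
    (fun j hj => hord j ⟨hj.1, hj.2.trans n.le_succ⟩) hu hw
  obtain ⟨y, rfl⟩ := IsAlgClosed.exists_pow_nat_eq z two_pos
  have h0 : 2 ^ n * r ≠ 0 := mul_ne_zero (by positivity) hr.pos.ne'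
  have h2 : 2 ∣ 2 ^ n * r := (dvd_pow_self 2 (by omega)).mul_right r
  have hordn := hord (n + 1) ⟨by omega, le_rfl⟩
  rw [pow_succ', mul_assoc] at hordn
  obtain ⟨b, hab, -⟩ := exists_recurrenceStep_of_isPrimitiveRoot hd h0
    (hord n ⟨hAn, n.le_succ⟩) hordn ((isPrimitiveRoot_sq_iff h0 h2).1 hz) haz
  exact ⟨b, hab⟩

theorem isCompleteFactorization_coeffPoly {k : ℕ} (hA : 2 ≤ A) (hAk : A ≤ k) (hkn : k ≤ n)
    (hAq : 2 ^ A ∣ Fintype.card F - 1) (hr : Odd r) (hcop : (Fintype.card F).Coprime (2 ^ n * r))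
    (hd : Even d) (hord : ∀ j ∈ Set.Icc A k, orderOf (Fintype.card F : ZMod (2 ^ j * r)) = d)
    (hordn : orderOf (Fintype.card F : ZMod (2 ^ n * r)) = 2 ^ (n - k) * d) :
    IsCompleteFactorization (cyclotomic (2 ^ n * r) F)
      {f | ∃ u ∈ primRoots F (2 ^ A), ∃ w ∈ primRoots F r, ∃ a : ℕ → F,
        IsCoeffs (Fintype.card F) A d u w k a ∧
        f = (coeffPoly d (2 ^ (n - k)) a).map (algebraMap F (AlgebraicClosure F))} := by
  have hk0 : 2 ^ k * r ≠ 0 := mul_ne_zero (by positivity) hr.pos.ne'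
  rw [← hord k ⟨hAk, le_rfl⟩] at hordn
  rw [← pow_sub_mul_pow 2 hkn, mul_assoc] at hcop hordn ⊢
  convert isCompleteFactorization_cyclotomic_expand hcop
    ((primeFactors_two_pow_subset _ (by omega)).trans
      (Nat.primeFactors_mono (dvd_mul_right _ r) hk0)) hordn using 1
  ext f
  constructor
  · rintro ⟨u, hu, w, hw, a, ha, rfl⟩
    obtain ⟨z, hz, haz⟩ := ha.exists_coeffPoly_eq_minpoly hA hAq hr hd hord hu hw
    exact ⟨z, hz, by rw [coeffPoly_eq_expand, map_expand, haz]⟩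
  · rintro ⟨z, hz, rfl⟩
    obtain ⟨u, hu, w, hw, a, ha, haz⟩ := exists_isCoeffs_of_isPrimitiveRoot hA hAq hr hd hAk hord hz
    exact ⟨u, hu, w, hw, a, ha, by rw [coeffPoly_eq_expand, map_expand, haz]⟩

end IsCoeffs

end CyclotomicFactorization

open CyclotomicFactorization in
theorem mainTheorem1 {F : Type*} [Field F] [Fintype F] (q A m r d K : ℕ)
    (hq : Fintype.card F = q) (hqA : q = 2 ^ A * m + 1) (hA : 2 ≤ A) (hm : Odd m)
    (hr3 : 3 ≤ r) (hr : Odd r) (hqr : Nat.Coprime q r)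
    (hd : d = orderOf (q : ZMod r)) (hK : K = padicValNat 2 (q ^ d - 1)) :
    -- 1. `n = 1` (the only factor `x + 1` of `Φ_2` has `u = 1`)
    IsCompleteFactorization (Polynomial.cyclotomic (2 * r) F)
      {f | ∃ w ∈ primRoots F r, f = twistedFactor q d 1 1 w} ∧
    -- 1. `2 ≤ n ≤ A`
    (∀ n, 2 ≤ n → n ≤ A →
      IsCompleteFactorization (Polynomial.cyclotomic (2 ^ n * r) F)
        {f | ∃ u ∈ primRoots F (2 ^ n), ∃ w ∈ primRoots F r, f = twistedFactor q d 1 u w}) ∧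
    -- 2 (a)
    (Odd d → ∀ n, A < n →
      IsCompleteFactorization (Polynomial.cyclotomic (2 ^ n * r) F)
        {f | ∃ u ∈ primRoots F (2 ^ A), ∃ w ∈ primRoots F r,
          f = twistedFactor q d (2 ^ (n - A)) u w}) ∧
    -- 2 (b)
    (Even d →
      -- the initial values lie in `F`, and the system is solvable in `F` at each step up to `K`
      (∀ u ∈ primRoots F (2 ^ A), ∀ w ∈ primRoots F r,
        (∃ a : ℕ → F, IsCoeffs q A d u w A a) ∧
        ∀ n, A < n → n ≤ K → ∀ a : ℕ → F, IsCoeffs q A d u w (n - 1) a →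
          ∃ b : ℕ → F, RecurrenceStep d a b) ∧
      -- (i)
      (∀ n, A < n → n ≤ K →
        IsCompleteFactorization (Polynomial.cyclotomic (2 ^ n * r) F)
          {f | ∃ u ∈ primRoots F (2 ^ A), ∃ w ∈ primRoots F r, ∃ a : ℕ → F,
            IsCoeffs q A d u w n a ∧
            f = (coeffPoly d 1 a).map (algebraMap F (AlgebraicClosure F))}) ∧
      -- (ii)
      (∀ n, K < n →
        IsCompleteFactorization (Polynomial.cyclotomic (2 ^ n * r) F)
          {f | ∃ u ∈ primRoots F (2 ^ A), ∃ w ∈ primRoots F r, ∃ a : ℕ → F,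
            IsCoeffs q A d u w K a ∧
            f = (coeffPoly d (2 ^ (n - K)) a).map (algebraMap F (AlgebraicClosure F))})) := by
  subst hq hd
  set q := Fintype.card F
  set d := orderOf (q : ZMod r)
  have hAq : 2 ^ A ∣ q - 1 := by simp only [hqA, Nat.add_sub_cancel, dvd_mul_right]
  have hodd : Odd q := by grind
  have hcop (n : ℕ) : q.Coprime (2 ^ n * r) :=
    ((Nat.coprime_two_right.2 hodd).pow_right n).mul_right hqr
  have hKA : K = A + padicValNat 2 d := hK.trans <| padicValNat_two_pow_sub_one_of_eq hqA hA hm <|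
    orderOf_natCast_ne_zero_of_coprime hr.pos.ne' hqr
  have hord (n : ℕ) : orderOf (q : ZMod (2 ^ n * r)) = 2 ^ (n - K) * d :=
    hK ▸ orderOf_natCast_two_pow_mul Fintype.one_lt_card hr hqr
      ((pow_dvd_pow 2 hA).trans (hAq.trans (Nat.sub_one_dvd_pow_sub_one q d))) n
  have hordK {n : ℕ} (hn : n ≤ K) : orderOf (q : ZMod (2 ^ n * r)) = d := by simp [hord, hn]
  refine ⟨isCompleteFactorization_twistedFactor_two_mul hodd hr hqr, fun n h2n hnA => ?_,
    fun hdodd n hAn => ?_, fun hdeven => ⟨fun u hu w hw => ⟨?_, fun n hAn hnK a ha => ?_⟩,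
      fun n hAn hnK => ?_, fun n hKn => ?_⟩⟩
  · exact isCompleteFactorization_twistedFactor_of_dvd_sub_one (pow_dvd_pow 2 h2n)
      ((pow_dvd_pow 2 hnA).trans hAq) ((Nat.coprime_two_left.2 hr).pow_left n) (hcop n)
  · have hKA' : K = A := by simp [hKA, hdodd.not_two_dvd_nat]
    exact isCompleteFactorization_twistedFactor_two_pow hA hAn.le hAq hr (hcop n) (hKA' ▸ hord n)
  · exact (exists_isCoeffs_initial hA hAq hr (hordK (by omega)) hu hw).imp fun _ => And.left
  · obtain ⟨n, rfl⟩ := Nat.exists_eq_add_of_lt hAn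
    exact ha.exists_recurrenceStep hA hAq hr hdeven (fun j hj => hordK (hj.2.trans hnK)) hu hw
  · simpa only [Nat.sub_self, pow_zero] using isCompleteFactorization_coeffPoly hA hAn.le le_rfl
      hAq hr (hcop n) hdeven (fun j hj => hordK (hj.2.trans hnK)) (by simpa using hordK hnK)
  · exact isCompleteFactorization_coeffPoly hA (by omega) hKn.le hAq hr (hcop n) hdeven
      (fun j hj => hordK hj.2) (hord n)
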